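/- Let $N\ge 2$, let $$C_N^D=\{x\in\mathbb R^N:\ x_1\ge\dots\ge x_{N-1}\ge |x_N|\}$$ and let $W_N^D=\{x\in\mathbb R^N:\ x_1>\dots>x_{N-1}>|x_N|\}$ be its interior. Consider on $W_N^D$ the ODE of type $D$ $$\frac{dx_i}{dt}(t)=\sum_{j\ne i}\Bigl(\frac1{x_i(t)-x_j(t)}+\frac1{x_i(t)+x_j(t)}\Bigr),\qquad i=1,\dots,N. \tag{D}$$ Then for every $x_0\in C_N^D$ there is a unique continuous function $x:[0,\infty)\to C_N^D$ with $x(0)=x_0$ such that $x(t)\in W_N^D$ for all $t>0$ and $x$ satisfies (D) on $(0,\infty)$. Moreover, suppose that the last coordinate of $x_0$ is $0$. Then a function $x:[0,\infty)\to\mathbb R^N$ is such a solution of (D) if and only if $x_N(t)=0$ for all $t\ge0$ and $\hat x:=(x_1,\dots,x_{N-1})$ is a solution of the ODE of type $B$ in dimension $N-1$ with parameter $\nu=2$ and starting point $(x_{0,1},\dots,x_{0,N-1})$, in the same sense: $\hat x$ is continuous on $[0,\infty)$ with values in $\{y\in\mathbb R^{N-1}: y_1\ge\dots\ge y_{N-1}\ge0\}$,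 starts at that point, lies in $\{y_1>\dots>y_{N-1}>0\}$ for $t>0$, and satisfies there $$\frac{d\hat x_i}{dt}(t)=\sum_{j\ne i}\Bigl(\frac1{\hat x_i(t)-\hat x_j(t)}+\frac1{\hat x_i(t)+\hat x_j(t)}\Bigr)+\frac{2}{\hat x_i(t)},\qquad i=1,\dots,N-1 .$$ -/

import Mathlib

open Set

/-- The closed Weyl chamber of type `D_N`: `x_1 ≥ ... ≥ x_{N-1} ≥ |x_N|`
(the coordinates are indexed by `0, ..., N-1`). -/
def chamberD (N : ℕ) : Set (EuclideanSpace ℝ (Fin N)) :=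
  {x | (∀ i j : Fin N, i < j → x j ≤ x i) ∧
    ∀ i j : Fin N, i < j → (j : ℕ) + 1 = N → |x j| ≤ x i}

/-- The closed Weyl chamber of type `B_N`: `x_1 ≥ ... ≥ x_N ≥ 0`. -/
def chamberB (N : ℕ) : Set (EuclideanSpace ℝ (Fin N)) :=
  {x | (∀ i j : Fin N, i < j → x j ≤ x i) ∧ ∀ i : Fin N, 0 ≤ x i}

/-- The right-hand side of the ODE of type `D_N`. -/
noncomputable def fieldD (N : ℕ) (x : EuclideanSpace ℝ (Fin N)) : EuclideanSpace ℝ (Fin N) :=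
  WithLp.toLp 2 fun i =>
    ∑ j ∈ Finset.univ.erase i, (1 / (x i - x j) + 1 / (x i + x j))

/-- The right-hand side of the ODE of type `B_N` with parameter `ν`. -/
noncomputable def fieldB (N : ℕ) (ν : ℝ) (x : EuclideanSpace ℝ (Fin N)) :
    EuclideanSpace ℝ (Fin N) :=
  WithLp.toLp 2 fun i =>
    ∑ j ∈ Finset.univ.erase i, (1 / (x i - x j) + 1 / (x i + x j)) + ν / x i

/-- `x : [0,∞) → C` is continuous, starts at `x₀`, lies in the interior of `C` for `t > 0`, and
satisfies `x' = H(x)` on `(0,∞)`. Only the values of `x` on `[0,∞)` matter. -/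
def IsChamberSolution {N : ℕ} (C : Set (EuclideanSpace ℝ (Fin N)))
    (H : EuclideanSpace ℝ (Fin N) → EuclideanSpace ℝ (Fin N))
    (x₀ : EuclideanSpace ℝ (Fin N)) (x : ℝ → EuclideanSpace ℝ (Fin N)) : Prop :=
  ContinuousOn x (Ici 0) ∧ x 0 = x₀ ∧ (∀ t, 0 ≤ t → x t ∈ C) ∧
    ∀ t, 0 < t → x t ∈ interior C ∧ HasDerivAt x (H (x t)) t

/-- The first `N - 1` coordinates of a vector. -/
noncomputable def dropLast {N : ℕ} (x : EuclideanSpace ℝ (Fin N)) :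
    EuclideanSpace ℝ (Fin (N - 1)) :=
  WithLp.toLp 2 fun i => x (Fin.castLE (Nat.sub_le N 1) i)

/-- From an interior point one may lower any coordinate a little. -/
theorem exists_lower_of_mem_interior {N : ℕ} {C : Set (EuclideanSpace ℝ (Fin N))}
    {x : EuclideanSpace ℝ (Fin N)} (hx : x ∈ interior C) (i : Fin N) :
    ∃ s : ℝ, 0 < s ∧ x - s • EuclideanSpace.single i (1 : ℝ) ∈ C := by
  have hc : Continuous fun s : ℝ => x - s • EuclideanSpace.single i (1 : ℝ) := by fun_prop
  have h0 : ∀ᶠ s in nhds (0 : ℝ), x - s • EuclideanSpace.single i (1 : ℝ) ∈ C := by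
    apply hc.continuousAt.eventually
    simpa using mem_interior_iff_mem_nhds.mp hx
  obtain ⟨ε, hε, h⟩ := Metric.eventually_nhds_iff.mp h0
  refine ⟨ε / 2, by positivity, h ?_⟩
  rw [Real.dist_eq, sub_zero, abs_of_pos (by positivity)]
  linarith

/-- The open chamber of type `D_N` is `x_1 > ... > x_{N-1} > |x_N|`. -/
theorem mem_interior_chamberD {N : ℕ} {x : EuclideanSpace ℝ (Fin N)} :
    x ∈ interior (chamberD N) ↔ (∀ i j : Fin N, i < j → x j < x i) ∧
      ∀ i j : Fin N, i < j → (j : ℕ) + 1 = N → |x j| < x i := by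
  constructor
  · intro hx
    constructor
    · intro i j hij
      obtain ⟨s, hs, h⟩ := exists_lower_of_mem_interior hx i
      have := h.1 i j hij
      simp [hij.ne'] at this
      linarith
    · intro i j hij hj
      obtain ⟨s, hs, h⟩ := exists_lower_of_mem_interior hx i
      have := h.2 i j hij hj
      simp [hij.ne'] at this
      linarith
  · intro hx
    refine mem_interior.mpr ⟨{x | (∀ i j : Fin N, i < j → x j < x i) ∧
      ∀ i j : Fin N, i < j → (j : ℕ) + 1 = N → |x j| < x i}, ?_, ?_, hx⟩
    · intro y hy
      exact ⟨fun i j h => (hy.1 i j h).le, fun i j h h' => (hy.2 i j h h').le⟩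
    · simp only [ofPred_and, ofPred_forall]
      refine IsOpen.inter ?_ ?_
      · refine isOpen_iInter_of_finite fun i => isOpen_iInter_of_finite fun j =>
          isOpen_iInter_of_finite fun _ => isOpen_lt (by fun_prop) (by fun_prop)
      · refine isOpen_iInter_of_finite fun i => isOpen_iInter_of_finite fun j =>
          isOpen_iInter_of_finite fun _ => isOpen_iInter_of_finite fun _ =>
            isOpen_lt (by fun_prop) (by fun_prop)

/-- The open chamber of type `B_N` is `x_1 > ... > x_N > 0`. -/
theorem mem_interior_chamberB {N : ℕ} {x : EuclideanSpace ℝ (Fin N)} :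
    x ∈ interior (chamberB N) ↔ (∀ i j : Fin N, i < j → x j < x i) ∧
      ∀ i : Fin N, 0 < x i := by
  constructor
  · intro hx
    constructor
    · intro i j hij
      obtain ⟨s, hs, h⟩ := exists_lower_of_mem_interior hx i
      have := h.1 i j hij
      simp [hij.ne'] at this
      linarith
    · intro i
      obtain ⟨s, hs, h⟩ := exists_lower_of_mem_interior hx i
      have := h.2 i
      simp at this
      linarith
  · intro hx
    refine mem_interior.mpr ⟨{x | (∀ i j : Fin N, i < j → x j < x i) ∧
      ∀ i : Fin N, 0 < x i}, ?_, ?_, hx⟩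
    · intro y hy
      exact ⟨fun i j h => (hy.1 i j h).le, fun i => (hy.2 i).le⟩
    · simp only [ofPred_and, ofPred_forall]
      refine IsOpen.inter ?_ ?_
      · refine isOpen_iInter_of_finite fun i => isOpen_iInter_of_finite fun j =>
          isOpen_iInter_of_finite fun _ => isOpen_lt (by fun_prop) (by fun_prop)
      · exact isOpen_iInter_of_finite fun i => isOpen_lt (by fun_prop) (by fun_prop)

/-! The type `D` field is `∑ a / ⟪a, x⟫` over the positive roots `a = e_p ± e_q`, the gradient of
the concave function `∑ log ⟪a, x⟫`. It is therefore dissipative: distances between solutions do not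
increase, which gives uniqueness even from a singular starting point (`IsRootFlow.eqOn`).

For existence, `1 / u` is frozen below `ε`, which makes the field bounded, Lipschitz and still
dissipative. Two bounds hold uniformly in `ε`: the flow moves at most `√(2 |S| t)` from `x₀`, where
`|S|` counts the roots, and after any positive time it stays a fixed distance from the walls
(`exists_le_inner_truncInv_flow`). The latter comes from pairing with a vector `ρ` positive on all
roots and from the decay of the speed. Hence the truncated flows are uniformly Cauchy, and their
limit solves the singular equation (`exists_isRootFlow`).

If `x_N` starts at `0`, it stays there because `x_N ^ 2` is nonincreasing. On `x_N = 0` the roots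
`e_i ± e_N` contribute `1 / x_i` each, which is the type `B` term with `ν = 2`. -/

open Filter Topology
open scoped RealInnerProductSpace NNReal

/-! ### Contraction and decay of speed for dissipative fields. -/

section Dissipative

variable {E : Type*} [NormedAddCommGroup E] [InnerProductSpace ℝ E]

/-- A function on `[s, ∞)` with nonpositive derivative is antitone. -/
theorem antitoneOn_Ici_of_hasDerivAt_nonpos {f f' : ℝ → ℝ} {s : ℝ} (hc : ContinuousOn f (Ici s))
    (hf : ∀ t, s < t → HasDerivAt f (f' t) t) (hf' : ∀ t, s < t → f' t ≤ 0) :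
    AntitoneOn f (Ici s) := by
  refine antitoneOn_of_deriv_nonpos (convex_Ici s) hc ?_ ?_
  · rw [interior_Ici]
    exact fun t ht => (hf t ht).differentiableAt.differentiableWithinAt
  · rw [interior_Ici]
    intro t ht
    rw [(hf t ht).deriv]
    exact hf' t ht

/-- Two trajectories whose velocities differ dissipatively approach each other. -/
theorem antitoneOn_norm_sub {x y x' y' : ℝ → E} {s : ℝ}
    (hxc : ContinuousOn x (Ici s)) (hyc : ContinuousOn y (Ici s))
    (hx : ∀ t, s < t → HasDerivAt x (x' t) t) (hy : ∀ t, s < t → HasDerivAt y (y' t) t)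
    (h : ∀ t, s < t → ⟪x t - y t, x' t - y' t⟫ ≤ 0) :
    AntitoneOn (fun t => ‖x t - y t‖) (Ici s) := by
  have key : AntitoneOn (fun t => ‖x t - y t‖ ^ 2) (Ici s) :=
    antitoneOn_Ici_of_hasDerivAt_nonpos ((hxc.sub hyc).norm.pow 2)
      (fun t ht => ((hx t ht).sub (hy t ht)).norm_sq)
      (fun t ht => by have := h t ht; simp only [Pi.sub_apply]; linarith)
  intro t ht u hu htu
  exact le_of_sq_le_sq (key ht hu htu) (norm_nonneg _)

/-- The speed along an integral curve of a dissipative autonomous field does not increase. -/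
theorem norm_field_antitone {F : E → E} {x : ℝ → E}
    (hF : ∀ u v, ⟪u - v, F u - F v⟫ ≤ 0) (hx : ∀ t, HasDerivAt x (F (x t)) t) :
    Antitone fun t => ‖F (x t)‖ := by
  intro s t hst
  have hlim : ∀ r, Tendsto (fun h : ℝ => ‖h⁻¹ • (x (r + h) - x r)‖) (𝓝[>] 0) (𝓝 ‖F (x r)‖) :=
    fun r => (hx r).tendsto_slope_zero_right.norm
  refine le_of_tendsto_of_tendsto (hlim t) (hlim s) ?_
  filter_upwards with h
  rw [norm_smul, norm_smul]
  refine mul_le_mul_of_nonneg_left ?_ (norm_nonneg _)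
  -- The field is autonomous, so the time shift by `h` is again an integral curve; its distance to
  -- the original does not increase, and neither do the difference quotients.
  have hc : Continuous x := continuous_iff_continuousAt.mpr fun t => (hx t).continuousAt
  have := antitoneOn_norm_sub (s := s) (x := fun r => x (r + h)) (y := x)
    (x' := fun r => F (x (r + h))) (y' := fun r => F (x r))
    (hc.comp (by fun_prop)).continuousOn hc.continuousOn
    (fun r _ => (hx (r + h)).comp_add_const r h) (fun r _ => hx r) (fun r _ => hF _ _)
  exact this self_mem_Ici hst hst

end Dissipative

/-! ### Global integral curves and the truncated inverse. -/

/-- A bounded Lipschitz autonomous vector field has global integral curves. -/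
theorem exists_global_integral_curve {E : Type*} [NormedAddCommGroup E] [NormedSpace ℝ E]
    [CompleteSpace E] {F : E → E} {K L : ℝ≥0} (hK : LipschitzWith K F) (hL : ∀ x, ‖F x‖ ≤ L)
    (x₀ : E) : ∃ x : ℝ → E, x 0 = x₀ ∧ ∀ t, HasDerivAt x (F (x t)) t := by
  have hloc : ∀ T : ℝ, 0 < T → ∃ x : ℝ → E, x 0 = x₀ ∧
      ∀ t ∈ Ioo (-T) T, HasDerivAt x (F (x t)) t := by
    intro T hT
    -- Speed at most `L` keeps the curve within `L * T` of `x₀` on `[-T, T]`, so a ball of that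
    -- radius suffices for any `T`.
    have hpl : IsPicardLindelof (fun _ => F) (tmin := -T) (tmax := T)
        ⟨0, by constructor <;> linarith⟩ x₀ (L * T.toNNReal) 0 L K :=
      .of_time_independent (fun x _ => hL x) hK.lipschitzOnWith (by simp [hT.le])
    obtain ⟨x, h0, hx⟩ := hpl.exists_eq_forall_mem_Icc_hasDerivWithinAt₀
    exact ⟨x, h0, fun t ht => (hx t (Ioo_subset_Icc_self ht)).hasDerivAt (Icc_mem_nhds ht.1 ht.2)⟩
  choose! γ hγ0 hγ using hloc
  have hagree : ∀ S T : ℝ, 0 < S → S ≤ T → EqOn (γ S) (γ T) (Ioo (-S) S) := by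
    intro S T hS hST
    refine ODE_solution_unique_of_mem_Ioo (v := fun _ => F) (s := fun _ => univ) (K := K)
      (t₀ := 0) (fun t _ => hK.lipschitzOnWith) ⟨by linarith, hS⟩
      (fun t ht => ⟨hγ S hS t ht, mem_univ _⟩)
      (fun t ht => ⟨hγ T (by linarith) t ⟨by linarith [ht.1], by linarith [ht.2]⟩, mem_univ _⟩) ?_
    rw [hγ0 S hS, hγ0 T (by linarith)]
  have hpos : ∀ t : ℝ, 0 < |t| + 1 := fun t => by positivity
  have hmem : ∀ t : ℝ, t ∈ Ioo (-(|t| + 1)) (|t| + 1) := fun t => abs_lt.mp (lt_add_one _)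
  refine ⟨fun t => γ (|t| + 1) t, hγ0 _ (hpos 0), fun t => ?_⟩
  refine (hγ _ (hpos t) t (hmem t)).congr_of_eventuallyEq ?_
  filter_upwards [Ioo_mem_nhds (hmem t).1 (hmem t).2] with s hs
  rcases le_total (|s| + 1) (|t| + 1) with h | h
  · exact hagree _ _ (hpos s) h (hmem s)
  · exact (hagree _ _ (hpos t) h hs).symm

/-- The function `u ↦ 1 / u`, frozen below `ε`. -/
noncomputable def truncInv (ε u : ℝ) : ℝ := (max u ε)⁻¹

section truncInv

variable {ε : ℝ}

theorem truncInv_pos (hε : 0 < ε) (u : ℝ) : 0 < truncInv ε u :=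
  inv_pos.mpr (lt_max_of_lt_right hε)

theorem truncInv_le (hε : 0 < ε) (u : ℝ) : truncInv ε u ≤ ε⁻¹ :=
  inv_anti₀ hε (le_max_right _ _)

theorem truncInv_eq_inv {u : ℝ} (h : ε ≤ u) : truncInv ε u = u⁻¹ := by
  rw [truncInv, max_eq_left h]

theorem truncInv_antitone (hε : 0 < ε) : Antitone (truncInv ε) := fun _ _ h =>
  inv_anti₀ (lt_max_of_lt_right hε) (max_le_max_right _ h)

theorem truncInv_mul_self_le (hε : 0 < ε) (u : ℝ) : truncInv ε u * u ≤ 1 := by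
  rw [truncInv, inv_mul_le_one₀ (lt_max_of_lt_right hε)]
  exact le_max_left _ _

theorem truncInv_lipschitz (hε : 0 < ε) : ∃ K, LipschitzWith K (truncInv ε) := by
  refine ⟨(ε⁻¹ * ε⁻¹).toNNReal, LipschitzWith.of_dist_le_mul fun u v => ?_⟩
  have hu : 0 < max u ε := lt_max_of_lt_right hε
  have hv : 0 < max v ε := lt_max_of_lt_right hε
  rw [Real.coe_toNNReal _ (by positivity), Real.dist_eq, Real.dist_eq, truncInv, truncInv,
    inv_sub_inv hu.ne' hv.ne', abs_div, abs_of_pos (mul_pos hu hv), div_eq_mul_inv, mul_inv,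
    mul_comm]
  refine mul_le_mul ?_ ?_ (abs_nonneg _) (by positivity)
  · exact mul_le_mul (truncInv_le hε u) (truncInv_le hε v) (truncInv_pos hε v).le (by positivity)
  · rw [abs_sub_comm u v]
    exact abs_max_sub_max_le_abs _ _ _

end truncInv

/-! ### Fields built from a finite family of vectors. -/

section RootField

variable {E : Type*} [NormedAddCommGroup E] [InnerProductSpace ℝ E] {ι : Type*}

/-- The vector field `x ↦ ∑ φ(⟪a k, x⟫) a k`. -/
noncomputable def rootField (S : Finset ι) (a : ι → E) (φ : ℝ → ℝ) (x : E) : E :=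
  ∑ k ∈ S, φ ⟪a k, x⟫ • a k

variable {S : Finset ι} {a : ι → E} {ρ : E}

theorem inner_rootField (φ : ℝ → ℝ) (x y : E) :
    ⟪y, rootField S a φ x⟫ = ∑ k ∈ S, φ ⟪a k, x⟫ * ⟪a k, y⟫ := by
  simp only [rootField, inner_sum, inner_smul_right, real_inner_comm]

theorem rootField_congr {φ ψ : ℝ → ℝ} {x : E} (h : ∀ k ∈ S, φ ⟪a k, x⟫ = ψ ⟪a k, x⟫) :
    rootField S a φ x = rootField S a ψ x :=
  Finset.sum_congr rfl fun k hk => by rw [h k hk]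

/-- The pairing is a sum of terms `(φ u - φ v) * (u - v)`, each nonpositive for antitone `φ`. -/
theorem rootField_dissipative {φ : ℝ → ℝ} {C : Set ℝ} (hφ : AntitoneOn φ C) {x y : E}
    (hx : ∀ k ∈ S, ⟪a k, x⟫ ∈ C) (hy : ∀ k ∈ S, ⟪a k, y⟫ ∈ C) :
    ⟪x - y, rootField S a φ x - rootField S a φ y⟫ ≤ 0 := by
  rw [inner_sub_right, inner_rootField, inner_rootField, ← Finset.sum_sub_distrib]
  refine Finset.sum_nonpos fun k hk => ?_
  rw [← sub_mul, inner_sub_right]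
  rcases le_total ⟪a k, x⟫ ⟪a k, y⟫ with h | h
  · exact mul_nonpos_of_nonneg_of_nonpos (sub_nonneg.mpr (hφ (hx k hk) (hy k hk) h))
      (sub_nonpos.mpr h)
  · exact mul_nonpos_of_nonpos_of_nonneg (sub_nonpos.mpr (hφ (hy k hk) (hx k hk) h))
      (sub_nonneg.mpr h)

theorem rootField_lipschitz {φ : ℝ → ℝ} (hφ : ∃ K, LipschitzWith K φ) :
    ∃ K, LipschitzWith K (rootField S a φ) := by
  obtain ⟨K, hK⟩ := hφ
  refine ⟨∑ k ∈ S, K * ‖a k‖₊ * ‖a k‖₊, LipschitzWith.of_dist_le_mul fun x y => ?_⟩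
  rw [dist_eq_norm, dist_eq_norm, rootField, rootField, ← Finset.sum_sub_distrib]
  push_cast
  rw [Finset.sum_mul]
  refine norm_sum_le_of_le _ fun k _ => ?_
  rw [← sub_smul, norm_smul]
  have h1 := hK.dist_le_mul ⟪a k, x⟫ ⟪a k, y⟫
  rw [dist_eq_norm, dist_eq_norm, ← inner_sub_right] at h1
  have h2 := norm_inner_le_norm (𝕜 := ℝ) (a k) (x - y)
  calc _ ≤ (K * (‖a k‖ * ‖x - y‖)) * ‖a k‖ := by gcongr; exact h1.trans (by gcongr)
    _ = _ := by ring

theorem norm_rootField_le {φ : ℝ → ℝ} {M : ℝ} {x : E} (h0 : ∀ k ∈ S, 0 ≤ φ ⟪a k, x⟫)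
    (hM : ∀ k ∈ S, φ ⟪a k, x⟫ ≤ M) : ‖rootField S a φ x‖ ≤ M * ∑ k ∈ S, ‖a k‖ := by
  rw [Finset.mul_sum]
  refine norm_sum_le_of_le _ fun k hk => ?_
  rw [norm_smul, Real.norm_of_nonneg (h0 k hk)]
  exact mul_le_mul_of_nonneg_right (hM k hk) (norm_nonneg _)

/-- All terms of the pairing with `ρ` are nonnegative, so none can cancel; one scalar thus controls
every coefficient of the field. -/
theorem le_inner_rootField {φ : ℝ → ℝ} {x : E} (hρ : ∀ k ∈ S, 1 ≤ ⟪a k, ρ⟫)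
    (h0 : ∀ k ∈ S, 0 ≤ φ ⟪a k, x⟫) {k : ι} (hk : k ∈ S) :
    φ ⟪a k, x⟫ ≤ ⟪ρ, rootField S a φ x⟫ := by
  rw [inner_rootField]
  refine le_trans (le_mul_of_one_le_right (h0 k hk) (hρ k hk)) ?_
  exact Finset.single_le_sum (f := fun k => φ ⟪a k, x⟫ * ⟪a k, ρ⟫)
    (fun j hj => mul_nonneg (h0 j hj) (zero_le_one.trans (hρ j hj))) hk

end RootField

/-! ### Uniform estimates for truncated flows and passage to the limit. -/

section RootFlow

variable {E : Type*} [NormedAddCommGroup E] [InnerProductSpace ℝ E] {ι : Type*}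
  {S : Finset ι} {a : ι → E} {ρ x₀ : E}

theorem rootField_truncInv_dissipative {ε : ℝ} (hε : 0 < ε) (x y : E) :
    ⟪x - y, rootField S a (truncInv ε) x - rootField S a (truncInv ε) y⟫ ≤ 0 :=
  rootField_dissipative (C := univ) ((truncInv_antitone hε).antitoneOn _) (by simp) (by simp)

theorem rootField_inv_dissipative {x y : E} (hx : ∀ k ∈ S, 0 < ⟪a k, x⟫)
    (hy : ∀ k ∈ S, 0 < ⟪a k, y⟫) :
    ⟪x - y, rootField S a (·⁻¹) x - rootField S a (·⁻¹) y⟫ ≤ 0 :=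
  rootField_dissipative (C := Ioi 0) (fun _ hu _ _ h => inv_anti₀ hu h) hx hy

theorem exists_truncInv_flow [CompleteSpace E] {ε : ℝ} (hε : 0 < ε) (x₀ : E) :
    ∃ x : ℝ → E, x 0 = x₀ ∧ ∀ t, HasDerivAt x (rootField S a (truncInv ε) (x t)) t := by
  obtain ⟨K, hK⟩ := rootField_lipschitz (S := S) (a := a) (truncInv_lipschitz hε)
  refine exists_global_integral_curve (L := (ε⁻¹ * ∑ k ∈ S, ‖a k‖).toNNReal) hK (fun x => ?_) x₀
  rw [Real.coe_toNNReal _ (by positivity)]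
  exact norm_rootField_le (fun k _ => (truncInv_pos hε _).le) (fun k _ => truncInv_le hε _)

section Estimates

variable {ε : ℝ} {x : ℝ → E}

/-- The truncated flow leaves a starting point in the closed chamber at a universal rate. -/
theorem norm_truncInv_flow_sub_le (hε : 0 < ε) (hx₀ : ∀ k ∈ S, 0 ≤ ⟪a k, x₀⟫) (h0 : x 0 = x₀)
    (hx : ∀ t, HasDerivAt x (rootField S a (truncInv ε) (x t)) t) {t : ℝ} (ht : 0 ≤ t) :
    ‖x t - x₀‖ ≤ √(2 * S.card * t) := by
  have hd : ∀ t, HasDerivAt (fun t => ‖x t - x₀‖ ^ 2 - 2 * S.card * t)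
      (2 * ⟪x t - x₀, rootField S a (truncInv ε) (x t)⟫ - 2 * S.card * 1) t := fun t =>
    ((hx t).sub_const x₀).norm_sq.sub ((hasDerivAt_id t).const_mul _)
  have hanti := antitoneOn_Ici_of_hasDerivAt_nonpos (s := 0)
    (fun t _ => (hd t).continuousAt.continuousWithinAt) (fun t _ => hd t) (fun t _ => by
      -- With `u = ⟪a k, x t⟫` and `u₀ = ⟪a k, x₀⟫ ≥ 0`, each root contributes `φ u * (u - u₀) ≤ φ u
      -- * u ≤ 1`.
      have : ⟪x t - x₀, rootField S a (truncInv ε) (x t)⟫ ≤ S.card := by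
        rw [inner_rootField, Finset.card_eq_sum_ones, Nat.cast_sum]
        refine Finset.sum_le_sum fun k hk => ?_
        rw [inner_sub_right, mul_sub, Nat.cast_one]
        linarith [truncInv_mul_self_le hε ⟪a k, x t⟫,
          mul_nonneg (truncInv_pos hε ⟪a k, x t⟫).le (hx₀ k hk)]
      linarith)
  have := hanti self_mem_Ici ht ht
  simp only [h0, sub_self, norm_zero] at this
  exact Real.le_sqrt_of_sq_le (by linarith)

/-- The displacement bound limits the mean of `⟪ρ, x'⟫` over `[0, t]`, hence its value at some
intermediate `s`. There it dominates all coefficients and so the speed, which can only decrease from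
`s` to `t`. -/
theorem norm_field_truncInv_flow_le (hε : 0 < ε) (hρ : ∀ k ∈ S, 1 ≤ ⟪a k, ρ⟫)
    (hx₀ : ∀ k ∈ S, 0 ≤ ⟪a k, x₀⟫) (h0 : x 0 = x₀)
    (hx : ∀ t, HasDerivAt x (rootField S a (truncInv ε) (x t)) t) {t : ℝ} (ht : 0 < t) :
    ‖rootField S a (truncInv ε) (x t)‖ ≤ ‖ρ‖ * √(2 * S.card * t) / t * ∑ k ∈ S, ‖a k‖ := by
  have hd : ∀ s, HasDerivAt (fun s => ⟪ρ, x s⟫) ⟪ρ, rootField S a (truncInv ε) (x s)⟫ s :=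
    fun s => by simpa using (hasDerivAt_const s ρ).inner ℝ (hx s)
  obtain ⟨s, hs, hs'⟩ := exists_hasDerivAt_eq_slope (fun s => ⟪ρ, x s⟫) _ ht
    (fun s _ => (hd s).continuousAt.continuousWithinAt) (fun s _ => hd s)
  have hbound : ⟪ρ, rootField S a (truncInv ε) (x s)⟫ ≤ ‖ρ‖ * √(2 * S.card * t) / t := by
    rw [hs', sub_zero, ← inner_sub_right, h0]
    gcongr
    exact (real_inner_le_norm _ _).trans
      (by gcongr; exact norm_truncInv_flow_sub_le hε hx₀ h0 hx ht.le)
  calc ‖rootField S a (truncInv ε) (x t)‖ ≤ ‖rootField S a (truncInv ε) (x s)‖ :=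
        norm_field_antitone (rootField_truncInv_dissipative hε) hx hs.2.le
    _ ≤ _ := norm_rootField_le (fun k _ => (truncInv_pos hε _).le) fun k hk =>
        (le_inner_rootField hρ (fun k _ => (truncInv_pos hε _).le) hk).trans hbound

/-- After any positive time, the truncated flows stay away from the walls, uniformly in the
truncation parameter. -/
theorem exists_le_inner_truncInv_flow (hρ : ∀ k ∈ S, 1 ≤ ⟪a k, ρ⟫)
    (hx₀ : ∀ k ∈ S, 0 ≤ ⟪a k, x₀⟫) {t : ℝ} (ht : 0 < t) :
    ∃ δ > 0, ∀ ε, 0 < ε → ε < δ → ∀ x : ℝ → E, x 0 = x₀ →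
      (∀ t, HasDerivAt x (rootField S a (truncInv ε) (x t)) t) →
      ∀ τ, t ≤ τ → ∀ k ∈ S, δ ≤ ⟪a k, x τ⟫ := by
  set B := ‖ρ‖ * (‖ρ‖ * √(2 * S.card * t) / t * ∑ k ∈ S, ‖a k‖) with hB
  have hB0 : 0 ≤ B := by positivity
  -- The coefficients are at most `B < B + 1`, so `max u ε` exceeds `(B + 1)⁻¹`; as `ε` is below
  -- that, the maximum must be `u`.
  refine ⟨(B + 1)⁻¹, by positivity, fun ε hε hεδ x h0 hx τ hτ k hk => ?_⟩
  have h1 : truncInv ε ⟪a k, x τ⟫ ≤ B := by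
    refine (le_inner_rootField hρ (fun k _ => (truncInv_pos hε _).le) hk).trans ?_
    refine (real_inner_le_norm _ _).trans ?_
    rw [hB]
    gcongr
    exact (norm_field_antitone (rootField_truncInv_dissipative hε) hx hτ).trans
      (norm_field_truncInv_flow_le hε hρ hx₀ h0 hx ht)
  have h2 : (B + 1)⁻¹ < max ⟪a k, x τ⟫ ε :=
    inv_lt_of_inv_lt₀ (lt_max_of_lt_right hε) (h1.trans_lt (lt_add_one B))
  rcases lt_max_iff.mp h2 with h | h
  · exact h.le
  · exact absurd h hεδ.not_gt

end Estimates

/-- A continuous curve which starts at `x₀` and for positive times lies in the open chamber and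
follows the singular field `x ↦ ∑ a k / ⟪a k, x⟫`. -/
def IsRootFlow (S : Finset ι) (a : ι → E) (x₀ : E) (x : ℝ → E) : Prop :=
  ContinuousOn x (Ici 0) ∧ x 0 = x₀ ∧
    ∀ t, 0 < t → (∀ k ∈ S, 0 < ⟪a k, x t⟫) ∧ HasDerivAt x (rootField S a (·⁻¹) (x t)) t

/-- The distance is nonincreasing and starts at `0`; at time `0` only continuity is needed. -/
theorem IsRootFlow.eqOn {x y : ℝ → E} (hx : IsRootFlow S a x₀ x) (hy : IsRootFlow S a x₀ y) :
    EqOn x y (Ici 0) := by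
  intro t ht
  have := antitoneOn_norm_sub hx.1 hy.1 (fun t ht => (hx.2.2 t ht).2) (fun t ht => (hy.2.2 t ht).2)
    (fun t ht => rootField_inv_dissipative (hx.2.2 t ht).1 (hy.2.2 t ht).1) self_mem_Ici ht ht
  simp only [hx.2.1, hy.2.1, sub_self, norm_zero] at this
  exact sub_eq_zero.mp (norm_le_zero_iff.mp this)

/-- The truncated flows from a common starting point in the closed chamber are uniformly close. -/
theorem exists_norm_truncInv_flow_sub_le (hρ : ∀ k ∈ S, 1 ≤ ⟪a k, ρ⟫)
    (hx₀ : ∀ k ∈ S, 0 ≤ ⟪a k, x₀⟫) {η : ℝ} (hη : 0 < η) :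
    ∃ δ > 0, ∀ ε ε', 0 < ε → ε < δ → 0 < ε' → ε' < δ → ∀ x y : ℝ → E, x 0 = x₀ → y 0 = x₀ →
      (∀ t, HasDerivAt x (rootField S a (truncInv ε) (x t)) t) →
      (∀ t, HasDerivAt y (rootField S a (truncInv ε') (y t)) t) →
      ∀ τ, 0 ≤ τ → ‖x τ - y τ‖ ≤ 2 * η := by
  -- Chosen so that `2 * S.card * t ≤ η ^ 2`; the `+ 1` covers empty `S`. Up to `t` both flows are
  -- `η`-close to `x₀`.
  set t := η ^ 2 / (2 * S.card + 1) with ht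
  have ht0 : 0 < t := by positivity
  have hsmall : ∀ τ ≤ t, √(2 * S.card * τ) ≤ η := by
    intro τ hτ
    refine Real.sqrt_le_iff.mpr ⟨hη.le, ?_⟩
    calc 2 * S.card * τ ≤ (2 * S.card + 1) * t := by nlinarith [Nat.cast_nonneg (α := ℝ) S.card]
      _ = η ^ 2 := by rw [ht]; field_simp
  obtain ⟨δ, hδ, h⟩ := exists_le_inner_truncInv_flow hρ hx₀ ht0
  refine ⟨δ, hδ, fun ε ε' hε hεδ hε' hεδ' x y hx0 hy0 hx hy τ hτ => ?_⟩
  have hearly : ∀ τ, 0 ≤ τ → τ ≤ t → ‖x τ - y τ‖ ≤ 2 * η := by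
    intro τ hτ hτt
    have h1 := (norm_truncInv_flow_sub_le hε hx₀ hx0 hx hτ).trans (hsmall τ hτt)
    have h2 := (norm_truncInv_flow_sub_le hε' hx₀ hy0 hy hτ).trans (hsmall τ hτt)
    have h3 := norm_sub_le_norm_sub_add_norm_sub (x τ) x₀ (y τ)
    rw [norm_sub_rev x₀] at h3
    linarith
  rcases le_total τ t with hτt | hτt
  · exact hearly τ hτ hτt
  · refine le_trans ?_ (hearly t ht0.le le_rfl)
    have hpos := h ε hε hεδ x hx0 hx
    have hpos' := h ε' hε' hεδ' y hy0 hy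
    refine antitoneOn_norm_sub (s := t) (fun t _ => (hx t).continuousAt.continuousWithinAt)
      (fun t _ => (hy t).continuousAt.continuousWithinAt) (fun t _ => hx t) (fun t _ => hy t)
      (fun r hr => ?_) self_mem_Ici hτt hτt
    -- Beyond `t` neither truncation is active: both flows follow the same singular field and
    -- contract.
    rw [rootField_congr fun k hk => truncInv_eq_inv (hεδ.le.trans (hpos r hr.le k hk)),
      rootField_congr fun k hk => truncInv_eq_inv (hεδ'.le.trans (hpos' r hr.le k hk))]
    exact rootField_inv_dissipative (fun k hk => hδ.trans_le (hpos r hr.le k hk))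
      (fun k hk => hδ.trans_le (hpos' r hr.le k hk))

/-- Existence of the flow from every point of the closed chamber. -/
theorem exists_isRootFlow [CompleteSpace E] (hρ : ∀ k ∈ S, 1 ≤ ⟪a k, ρ⟫)
    (hx₀ : ∀ k ∈ S, 0 ≤ ⟪a k, x₀⟫) : ∃ x, IsRootFlow S a x₀ x := by
  have hε : ∀ n : ℕ, (0 : ℝ) < 1 / (n + 1) := fun n => Nat.one_div_pos_of_nat
  have hlt : ∀ δ : ℝ, 0 < δ → ∀ᶠ n : ℕ in atTop, 1 / ((n : ℝ) + 1) < δ := fun δ hδ =>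
    (tendsto_one_div_add_atTop_nhds_zero_nat (𝕜 := ℝ)).eventually_lt_const hδ
  choose X hX0 hX using fun n => exists_truncInv_flow (S := S) (a := a) (hε n) x₀
  have hXc : ∀ n, Continuous (X n) := fun n =>
    continuous_iff_continuousAt.mpr fun t => (hX n t).continuousAt
  have hcauchy : UniformCauchySeqOn X atTop (Ici 0) := by
    rw [Metric.uniformCauchySeqOn_iff]
    intro η hη
    obtain ⟨δ, hδ, h⟩ := exists_norm_truncInv_flow_sub_le hρ hx₀ (show 0 < η / 3 by positivity)
    obtain ⟨n₀, hn₀⟩ := eventually_atTop.mp (hlt δ hδ)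
    refine ⟨n₀, fun m hm n hn t ht => ?_⟩
    rw [dist_eq_norm]
    linarith [h _ _ (hε m) (hn₀ m hm) (hε n) (hn₀ n hn) _ _ (hX0 m) (hX0 n) (hX m) (hX n) t ht]
  have hlim : ∀ t, 0 ≤ t → ∃ y, Tendsto (fun n => X n t) atTop (𝓝 y) := fun t ht =>
    cauchySeq_tendsto_of_complete (hcauchy.cauchySeq ht)
  choose! x hx using hlim
  have hunif : TendstoUniformlyOn X x atTop (Ici 0) := hcauchy.tendstoUniformlyOn_of_tendsto hx
  refine ⟨x, hunif.continuousOn (Frequently.of_forall fun n => (hXc n).continuousOn),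
    tendsto_nhds_unique (hx 0 le_rfl) (by simp [hX0]), fun t ht => ?_⟩
  obtain ⟨δ, hδ, h⟩ := exists_le_inner_truncInv_flow hρ hx₀ (half_pos ht)
  have hlow : ∀ τ, t / 2 ≤ τ → ∀ k ∈ S, δ ≤ ⟪a k, x τ⟫ := by
    intro τ hτ k hk
    refine ge_of_tendsto (tendsto_const_nhds.inner (hx τ (by linarith))) ?_
    filter_upwards [hlt δ hδ] with n hn
    exact h _ (hε n) hn _ (hX0 n) (hX n) τ hτ k hk
  have htrunc : ∀ τ, t / 2 ≤ τ →
      rootField S a (truncInv δ) (x τ) = rootField S a (·⁻¹) (x τ) := fun τ hτ =>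
    rootField_congr fun k hk => truncInv_eq_inv (hlow τ hτ k hk)
  refine ⟨fun k hk => hδ.trans_le (hlow t (by linarith) k hk), ?_⟩
  -- Near `t` the singular field may be replaced by the one truncated at `δ`. That one is Lipschitz,
  -- so uniform convergence of the curves passes to the velocities.
  rw [← htrunc t (by linarith)]
  obtain ⟨K, hK⟩ := rootField_lipschitz (S := S) (a := a) (truncInv_lipschitz hδ)
  refine hasDerivAt_of_tendstoUniformlyOn (f := X) (l := atTop) (s := Ioi (t / 2))
    (f' := fun n τ => rootField S a (truncInv δ) (X n τ))
    (g' := fun τ => rootField S a (truncInv δ) (x τ)) isOpen_Ioi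
    (hK.uniformContinuous.comp_tendstoUniformlyOn
      (hunif.mono fun τ hτ => (half_pos ht).le.trans (le_of_lt hτ))) ?_
    (fun τ hτ => hx τ ((half_pos ht).le.trans (le_of_lt hτ))) (half_lt_self ht)
  filter_upwards [hlt δ hδ] with n hn τ hτ
  have hpos := h _ (hε n) hn _ (hX0 n) (hX n) τ (le_of_lt hτ)
  convert hX n τ using 1
  refine rootField_congr fun k hk => ?_
  rw [truncInv_eq_inv (hpos k hk), truncInv_eq_inv (hn.le.trans (hpos k hk))]

end RootFlow

section EuclideanCoordinates

variable {N : ℕ} {x : ℝ → EuclideanSpace ℝ (Fin N)}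

theorem hasDerivAt_euclidean_iff {v : EuclideanSpace ℝ (Fin N)} {t : ℝ} :
    HasDerivAt x v t ↔ ∀ i, HasDerivAt (fun t => x t i) (v i) t := by
  rw [← hasDerivWithinAt_univ, hasDerivWithinAt_iff_hasFDerivWithinAt, hasFDerivWithinAt_euclidean]
  refine forall_congr' fun i => ?_
  rw [← hasDerivWithinAt_univ, hasDerivWithinAt_iff_hasFDerivWithinAt]
  have : (PiLp.proj 2 (fun _ : Fin N => ℝ) i).comp (ContinuousLinearMap.toSpanSingleton ℝ v) =
      ContinuousLinearMap.toSpanSingleton ℝ (v i) := by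
    ext; simp
  rw [← this]

theorem continuousOn_euclidean_iff {s : Set ℝ} :
    ContinuousOn x s ↔ ∀ i, ContinuousOn (fun t => x t i) s := by
  rw [← continuousOn_pi]
  exact ⟨fun h => (PiLp.continuous_ofLp 2 _).comp_continuousOn h,
    fun h => (PiLp.continuous_toLp 2 _).comp_continuousOn h⟩

end EuclideanCoordinates

/-! ### Type `D` roots, chamber and field. -/

section TypeD

/-- Index set of the positive roots of type `D_N`. -/
def posRootsD (N : ℕ) : Finset ((Fin N × Fin N) × Bool) :=
  (Finset.univ.filter fun p : Fin N × Fin N => p.1 < p.2) ×ˢ Finset.univ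

/-- The vectors `e_p + e_q` and `e_p - e_q`. -/
noncomputable def rootD (N : ℕ) (k : (Fin N × Fin N) × Bool) : EuclideanSpace ℝ (Fin N) :=
  EuclideanSpace.single k.1.1 1 + (if k.2 then 1 else -1 : ℝ) • EuclideanSpace.single k.1.2 1

variable {N : ℕ} {x : EuclideanSpace ℝ (Fin N)}

theorem inner_rootD (k : (Fin N × Fin N) × Bool) (x : EuclideanSpace ℝ (Fin N)) :
    ⟪rootD N k, x⟫ = x k.1.1 + (if k.2 then 1 else -1) * x k.1.2 := by
  rw [rootD, inner_add_left, inner_smul_left, EuclideanSpace.inner_single_left,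
    EuclideanSpace.inner_single_left]
  simp

theorem forall_posRootsD_iff {P : ℝ → Prop} : (∀ k ∈ posRootsD N, P ⟪rootD N k, x⟫) ↔
    ∀ i j : Fin N, i < j → P (x i - x j) ∧ P (x i + x j) := by
  simp [posRootsD, inner_rootD, sub_eq_add_neg, forall_and]

/-- Turns a sum over pairs `p < q`, as indexed by positive roots, into the sum over `j ≠ i`: each
`j` meets `i` in exactly one ordered pair. -/
theorem sum_lt_ite_add_ite (i : Fin N) (f : Fin N → Fin N → ℝ) :
    ∑ p, ∑ q, (if p < q then (if i = p then f p q else 0) + (if i = q then f q p else 0) else 0) =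
      ∑ j ∈ Finset.univ.erase i, f i j := by
  have hsplit : ∀ p q : Fin N,
      (if p < q then (if i = p then f p q else 0) + (if i = q then f q p else 0) else 0) =
        (if i = p then (if i < q then f i q else 0) else 0) +
          (if i = q then (if p < i then f i p else 0) else 0) := by
    intro p q
    split_ifs <;> grind
  simp only [hsplit, Finset.sum_add_distrib]
  rw [Finset.sum_comm (f := fun p q => if i = p then (if i < q then f i q else 0) else 0)]
  simp only [Finset.sum_ite_eq, Finset.mem_univ, if_true]
  rw [← Finset.sum_add_distrib, ← Finset.sum_filter_add_sum_filter_not Finset.univ (fun j => j = i)]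
  simp only [Finset.filter_eq', Finset.mem_univ, if_true, Finset.sum_singleton, lt_irrefl,
    if_false, add_zero, zero_add, Finset.filter_ne']
  refine Finset.sum_congr rfl fun j hj => ?_
  rcases lt_or_gt_of_ne (Finset.ne_of_mem_erase hj) with h | h <;> simp [h, h.not_gt]

theorem rootField_rootD (x : EuclideanSpace ℝ (Fin N)) :
    rootField (posRootsD N) (rootD N) (·⁻¹) x = fieldD N x := by
  ext i
  simp only [fieldD, rootField, inner_rootD]
  rw [← sum_lt_ite_add_ite i fun p q => 1 / (x p - x q) + 1 / (x p + x q)]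
  rw [posRootsD, Finset.sum_product, Finset.sum_filter, Fintype.sum_prod_type]
  simp only [WithLp.ofLp_sum, Finset.sum_apply]
  refine Finset.sum_congr rfl fun p _ => Finset.sum_congr rfl fun q _ => ?_
  split_ifs with hpq h1 h2 h2
  · exact absurd (h1.symm.trans h2) hpq.ne
  · subst h1
    simp [rootD, h2, ← sub_eq_add_neg, add_comm]
  · subst h2
    have : (x i - x p)⁻¹ = -(x p + -x i)⁻¹ := by rw [← inv_neg]; ring
    simp [rootD, h1, this, add_comm]
  · simp [rootD, h1, h2]
  · simp

theorem mem_interior_chamberD_iff_posRootsD :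
    x ∈ interior (chamberD N) ↔ ∀ k ∈ posRootsD N, 0 < ⟪rootD N k, x⟫ := by
  rw [mem_interior_chamberD, forall_posRootsD_iff (P := fun u => 0 < u)]
  constructor
  · rintro ⟨h1, h2⟩ i j hij
    refine ⟨sub_pos.mpr (h1 i j hij), ?_⟩
    by_cases hj : (j : ℕ) + 1 = N
    · linarith [(abs_lt.mp (h2 i j hij hj)).1]
    -- The absolute value bound is imposed for the last index `l` only; here it gives `x j > |x l| ≥
    -- 0`, and likewise for `x i`.
    · have hj' := j.isLt
      let l : Fin N := ⟨N - 1, by omega⟩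
      have hjl : j < l := Fin.lt_def.mpr (by simp only [l]; omega)
      have hl : (l : ℕ) + 1 = N := by simp only [l]; omega
      linarith [h2 j l hjl hl, h2 i l (hij.trans hjl) hl, abs_nonneg (x l)]
  · intro h
    refine ⟨fun i j hij => sub_pos.mp (h i j hij).1, fun i j hij _ => abs_lt.mpr ⟨?_, ?_⟩⟩ <;>
      linarith [(h i j hij).1, (h i j hij).2]

theorem inner_rootD_nonneg_of_mem_chamberD (hx : x ∈ chamberD N) :
    ∀ k ∈ posRootsD N, 0 ≤ ⟪rootD N k, x⟫ := by
  rw [forall_posRootsD_iff (P := fun u => 0 ≤ u)]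
  intro i j hij
  refine ⟨sub_nonneg.mpr (hx.1 i j hij), ?_⟩
  by_cases hj : (j : ℕ) + 1 = N
  · linarith [(abs_le.mp (hx.2 i j hij hj)).1]
  · have hj' := j.isLt
    let l : Fin N := ⟨N - 1, by omega⟩
    have hjl : j < l := Fin.lt_def.mpr (by simp only [l]; omega)
    have hl : (l : ℕ) + 1 = N := by simp only [l]; omega
    linarith [hx.2 j l hjl hl, hx.2 i l (hij.trans hjl) hl, abs_nonneg (x l)]

/-- The vector `(N-1, ..., 1, 0)`, which pairs to at least `1` with every positive root. -/
noncomputable def weylVectorD (N : ℕ) : EuclideanSpace ℝ (Fin N) :=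
  WithLp.toLp 2 fun i => (N : ℝ) - 1 - (i : ℕ)

theorem one_le_inner_rootD_weylVectorD :
    ∀ k ∈ posRootsD N, 1 ≤ ⟪rootD N k, weylVectorD N⟫ := by
  rw [forall_posRootsD_iff (P := fun u => 1 ≤ u)]
  intro i j hij
  have h1 : ((i : ℕ) : ℝ) + 1 ≤ (j : ℕ) := by exact_mod_cast hij
  have h2 : ((j : ℕ) : ℝ) + 1 ≤ N := by exact_mod_cast j.isLt
  simp only [weylVectorD]
  constructor <;> linarith

theorem isChamberSolution_chamberD_iff {x₀ : EuclideanSpace ℝ (Fin N)} (hx₀ : x₀ ∈ chamberD N)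
    {x : ℝ → EuclideanSpace ℝ (Fin N)} :
    IsChamberSolution (chamberD N) (fieldD N) x₀ x ↔
      IsRootFlow (posRootsD N) (rootD N) x₀ x := by
  simp only [IsChamberSolution, IsRootFlow, ← mem_interior_chamberD_iff_posRootsD, rootField_rootD]
  refine ⟨fun h => ⟨h.1, h.2.1, h.2.2.2⟩, fun h => ⟨h.1, h.2.1, fun t ht => ?_, h.2.2⟩⟩
  rcases ht.eq_or_lt with rfl | ht
  · rwa [h.2.1]
  · exact interior_subset (h.2.2 t ht).1

/-- A type `D` solution whose last coordinate starts at zero keeps it there. -/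
theorem IsChamberSolution.last_eq_zero {x₀ : EuclideanSpace ℝ (Fin N)}
    {x : ℝ → EuclideanSpace ℝ (Fin N)} (hx : IsChamberSolution (chamberD N) (fieldD N) x₀ x)
    {l : Fin N} (hl : (l : ℕ) + 1 = N) (h0 : x₀ l = 0) {t : ℝ} (ht : 0 ≤ t) : x t l = 0 := by
  have hanti := antitoneOn_Ici_of_hasDerivAt_nonpos (s := 0) (f := fun t => x t l ^ 2)
    (f' := fun t => 2 * (x t l * fieldD N (x t) l)) ((continuousOn_euclidean_iff.mp hx.1 l).pow 2)
    (fun t ht => ((hasDerivAt_euclidean_iff.mp (hx.2.2.2 t ht).2 l).fun_pow 2).congr_deriv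
      (by push_cast; ring))
    (fun t ht => by
      have hmem := (mem_interior_chamberD.mp (hx.2.2.2 t ht).1).2
      suffices x t l * fieldD N (x t) l ≤ 0 by linarith
      simp only [fieldD]
      rw [Finset.mul_sum]
      refine Finset.sum_nonpos fun j hj => ?_
      have hjl : j < l := by
        have := Fin.val_ne_of_ne (Finset.ne_of_mem_erase hj)
        have := j.isLt
        exact Fin.lt_def.mpr (by omega)
      obtain ⟨h1, h2⟩ := abs_lt.mp (hmem j l hjl hl)
      have h3 : x t l - x t j < 0 := by linarith
      have h4 : 0 < x t l + x t j := by linarith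
      -- Since `1 / (u - v) + 1 / (u + v) = 2 * u / (u ^ 2 - v ^ 2)`, the drift of `x_N` has sign
      -- opposite to `x_N` when `|u| < v`.
      have h5 : x t l * (1 / (x t l - x t j) + 1 / (x t l + x t j)) =
          2 * x t l ^ 2 / ((x t l - x t j) * (x t l + x t j)) := by
        field_simp [h3.ne, h4.ne']
        ring
      rw [h5]
      exact div_nonpos_of_nonneg_of_nonpos (by positivity)
        (mul_nonpos_of_nonpos_of_nonneg h3.le h4.le))
  have := hanti self_mem_Ici ht ht
  simp only [hx.2.1, h0] at this
  exact pow_eq_zero_iff two_ne_zero |>.mp (le_antisymm (by simpa using this) (sq_nonneg _))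

end TypeD

/-! ### Reduction of type `D` on `x_N = 0` to type `B`. -/

section DropLast

variable {M : ℕ} {x : EuclideanSpace ℝ (Fin (M + 1))}

theorem dropLast_mem_chamberB_iff (h : x (Fin.last M) = 0) :
    (dropLast x : EuclideanSpace ℝ (Fin M)) ∈ chamberB M ↔ x ∈ chamberD (M + 1) := by
  simp only [chamberB, chamberD, mem_ofPred_eq]
  constructor
  · rintro ⟨h1, h2⟩
    constructor
    · intro i j hij
      induction j using Fin.lastCases with
      | last =>
        obtain ⟨i, rfl⟩ := Fin.exists_castSucc_eq.mpr hij.ne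
        rw [h]; exact h2 i
      | cast j =>
        obtain ⟨i, rfl⟩ := Fin.exists_castSucc_eq.mpr (hij.trans (Fin.castSucc_lt_last j)).ne
        exact h1 i j hij
    · intro i j hij hj
      obtain rfl : j = Fin.last M := Fin.ext (by simpa using hj)
      obtain ⟨i, rfl⟩ := Fin.exists_castSucc_eq.mpr hij.ne
      rw [h, abs_zero]; exact h2 i
  · rintro ⟨h1, h2⟩
    refine ⟨fun i j hij => h1 _ _ hij, fun i => ?_⟩
    rw [← h]; exact h1 _ _ (Fin.castSucc_lt_last i)

theorem dropLast_mem_interior_chamberB_iff (h : x (Fin.last M) = 0) :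
    (dropLast x : EuclideanSpace ℝ (Fin M)) ∈ interior (chamberB M) ↔
      x ∈ interior (chamberD (M + 1)) := by
  have hd : ∀ i : Fin M, (dropLast x : EuclideanSpace ℝ (Fin M)) i = x i.castSucc := fun _ => rfl
  rw [mem_interior_chamberB, mem_interior_chamberD]
  simp only [hd]
  constructor
  · rintro ⟨h1, h2⟩
    constructor
    · intro i j hij
      induction j using Fin.lastCases with
      | last =>
        obtain ⟨i, rfl⟩ := Fin.exists_castSucc_eq.mpr hij.ne
        rw [h]; exact h2 i
      | cast j =>
        obtain ⟨i, rfl⟩ := Fin.exists_castSucc_eq.mpr (hij.trans (Fin.castSucc_lt_last j)).ne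
        exact h1 i j hij
    · intro i j hij hj
      obtain rfl : j = Fin.last M := Fin.ext (by simpa using hj)
      obtain ⟨i, rfl⟩ := Fin.exists_castSucc_eq.mpr hij.ne
      rw [h, abs_zero]; exact h2 i
  · rintro ⟨h1, h2⟩
    refine ⟨fun i j hij => h1 _ _ hij, fun i => ?_⟩
    rw [← h]; exact h1 _ _ (Fin.castSucc_lt_last i)

/-- The summand `j = N` is `1 / x_i + 1 / x_i`, the source of `ν = 2`. -/
theorem fieldD_castSucc (h : x (Fin.last M) = 0) (i : Fin M) :
    fieldD (M + 1) x i.castSucc = fieldB M 2 (dropLast x) i := by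
  have hd : ∀ i : Fin M, (dropLast x : EuclideanSpace ℝ (Fin M)) i = x i.castSucc := fun _ => rfl
  simp only [fieldD, fieldB, hd]
  rw [Finset.sum_erase_eq_sub (Finset.mem_univ _), Finset.sum_erase_eq_sub (Finset.mem_univ _),
    Fin.sum_univ_castSucc, h, sub_zero, add_zero]
  ring

theorem fieldD_last (h : x (Fin.last M) = 0) : fieldD (M + 1) x (Fin.last M) = 0 := by
  simp only [fieldD]
  refine Finset.sum_eq_zero fun j _ => ?_
  rw [h, zero_sub, zero_add, one_div, one_div, inv_neg, neg_add_cancel]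

/-- For curves in the hyperplane `x_N = 0`, the type `D` equation is the type `B` equation with
parameter `2`. -/
theorem isChamberSolution_dropLast_iff {x₀ : EuclideanSpace ℝ (Fin (M + 1))}
    (h₀ : x₀ (Fin.last M) = 0) {x : ℝ → EuclideanSpace ℝ (Fin (M + 1))}
    (h : ∀ t, 0 ≤ t → x t (Fin.last M) = 0) :
    IsChamberSolution (chamberB M) (fieldB M 2) (dropLast x₀) (fun t => dropLast (x t)) ↔
      IsChamberSolution (chamberD (M + 1)) (fieldD (M + 1)) x₀ x := by
  refine and_congr ?_ (and_congr ?_ (and_congr ?_ ?_))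
  · rw [continuousOn_euclidean_iff, continuousOn_euclidean_iff, Fin.forall_fin_succ']
    exact (and_iff_left (continuousOn_const.congr h)).symm
  · rw [PiLp.ext_iff, PiLp.ext_iff, Fin.forall_fin_succ']
    exact (and_iff_left ((h 0 le_rfl).trans h₀.symm)).symm
  · exact forall₂_congr fun t ht => dropLast_mem_chamberB_iff (h t ht)
  · refine forall₂_congr fun t ht =>
      and_congr (dropLast_mem_interior_chamberB_iff (h t ht.le)) ?_
    rw [hasDerivAt_euclidean_iff, hasDerivAt_euclidean_iff, Fin.forall_fin_succ',
      fieldD_last (h t ht.le)]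
    simp only [fieldD_castSucc (h t ht.le)]
    -- The equation for the last coordinate is automatic, as that coordinate vanishes identically
    -- near `t > 0`.
    refine (and_iff_left ?_).symm
    refine (hasDerivAt_const t (0 : ℝ)).congr_of_eventuallyEq ?_
    filter_upwards [Ioi_mem_nhds ht] with s hs using h s (le_of_lt hs)

end DropLast

theorem mainTheorem3 (N : ℕ) (hN : 2 ≤ N) (x₀ : EuclideanSpace ℝ (Fin N))
    (hx₀ : x₀ ∈ chamberD N) :
    (∃ x : ℝ → EuclideanSpace ℝ (Fin N),
      IsChamberSolution (chamberD N) (fieldD N) x₀ x ∧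
      ∀ y : ℝ → EuclideanSpace ℝ (Fin N),
        IsChamberSolution (chamberD N) (fieldD N) x₀ y → EqOn y x (Ici 0)) ∧
    (x₀ ⟨N - 1, by omega⟩ = 0 →
      ∀ x : ℝ → EuclideanSpace ℝ (Fin N),
        IsChamberSolution (chamberD N) (fieldD N) x₀ x ↔
          (∀ t, 0 ≤ t → x t ⟨N - 1, by omega⟩ = 0) ∧
          IsChamberSolution (chamberB (N - 1)) (fieldB (N - 1) 2) (dropLast x₀)
            (fun t => dropLast (x t))) := by
  constructor
  · obtain ⟨x, hx⟩ := exists_isRootFlow one_le_inner_rootD_weylVectorD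
      (inner_rootD_nonneg_of_mem_chamberD hx₀)
    exact ⟨x, (isChamberSolution_chamberD_iff hx₀).mpr hx, fun y hy =>
      ((isChamberSolution_chamberD_iff hx₀).mp hy).eqOn hx⟩
  · obtain ⟨M, rfl⟩ : ∃ M, N = M + 1 := ⟨N - 1, by omega⟩
    intro h₀ x
    constructor
    · intro hx
      have h : ∀ t, 0 ≤ t → x t (Fin.last M) = 0 := fun t ht => hx.last_eq_zero rfl h₀ ht
      exact ⟨h, (isChamberSolution_dropLast_iff h₀ h).mpr hx⟩
    · rintro ⟨h, hx⟩
      exact (isChamberSolution_dropLast_iff h₀ h).mp hx
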